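/- A signed graph $(G,\Sigma)$ is a finite loopless multigraph $G=(V,E)$ together with a set $\Sigma\subseteq E$ of odd edges (the other edges are even). Resigning on $S\subseteq V$ replaces $\Sigma$ by $\Sigma\,\Delta\,\delta(S)$, where $\delta(S)$ is the set of edges between $S$ and $V\setminus S$. Contracting an edge identifies its two ends and deletes all edges between them; the other edges keep their signs. $(G,\Sigma)$ is a splitting of $(H,\Sigma_H)$ if $(H,\Sigma_H)$ can be obtained from $(G,\Sigma)$ by a (possibly empty) sequence of resignings and contractions of even edges. For $c\in[-1,1]^E$, ${\rm P}(G,\Sigma,c)$ is the problem of finding a positive semidefinite matrix $X\in\mathbb{R}^{V\times V}$ with $X[i,i]=1$ for all $i\in V$, $X[i,j]\ge c(e)$ for every even edge $e=ij$ and $X[i,j]\le c(e)$ for every odd edge $e=ij$; $\mathcal{E}(G,\Sigma)$ is the set of all $c\in[-1,1]^E$ for which it is feasible. For $\omega\in\mathbb{R}^{V\cup E}$ let $\Omega=\sum_{i\in V}\omega(i)E_{ii}+\sum_{e=ij\in E}\omega(e)E_{ij}$ with $E_{ij}=(\boldsymbol e_i\boldsymbol e_j^\top+\boldsymbol e_j\boldsymbol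 e_i^\top)/2$. For $c\in\mathcal{E}(G,\Sigma)$ the singularity degree ${\sf sd}(G,\Sigma,c)$ is the smallest $k\ge 0$ for which there are $\omega^1,\dots,\omega^k\in\mathbb{R}^{V\cup E}$ with the following properties, where $\mathcal{V}^j=\{x\in\mathbb{R}^V : x^\top\Omega^i x=0\ (i=1,\dots,j)\}$: - $\omega^j(e)\le 0$ for even $e$ and $\omega^j(e)\ge 0$ for odd $e$, for every $j$; - $x^\top\Omega^j x\ge 0$ for all $x\in\mathcal{V}^{j-1}$, for every $j$; - $\sum_{i\in V}\omega^j(i)+\sum_{e\in E}\omega^j(e)c(e)\le 0$ for every $j$; - $\dim\mathcal{V}^k$ equals the maximum rank of a feasible solution of ${\rm P}(G,\Sigma,c)$. Such a $c$ is nondegenerate if $c(e)\ne 1$ for every even edge $e$ and $c(e)\neq -1$ for every odd edge $e$. Let ${\sf sd}(G,\Sigma)$ be the maximum of ${\sf sd}(G,\Sigma,c)$ over all $c\in\mathcal{E}(G,\Sigma)$, and ${\sf sd}^*(G,\Sigma)$ the maximum over all nondegenerate $c\in\mathcal{E}(G,\Sigma)$. (All these quantities take values in $\mathbb{N}\cup\{\infty\}$,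 with suprema in place of maxima and $\infty$ for the minimum of the empty set.) Lemma. For every signed graph $(G,\Sigma)$, $$ {\sf sd}(G,\Sigma)\le\max\left\{{\sf sd}^*(H,\Sigma_H)+1 : (G,\Sigma)\text{ is a splitting of }(H,\Sigma_H)\right\}, $$ where the maximum on the right is attained. -/

import Mathlib

/-- A (finite) signed graph: a multigraph, possibly with parallel edges but without loops, together
with a set `odd` of edges (written `Σ` in the literature). The edges in `odd` are called odd, the
other edges are called even. The vertices and the edges are taken from the types `α` and `β`, which
are finite in all that follows. -/
structure SignedGraph (α β : Type*) extends Graph α β where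
  loopless : toGraph.Loopless
  odd : Set β
  odd_subset : odd ⊆ edgeSet

namespace SignedGraph

variable {α β : Type*}

/-- The vertices of `G`, as a type. -/
abbrev Vert (G : SignedGraph α β) : Type _ := {v : α // v ∈ G.vertexSet}

/-- The edges of `G`, as a type. -/
abbrev Edge (G : SignedGraph α β) : Type _ := {e : β // e ∈ G.edgeSet}

/-! ### Resigning, contraction, splitting -/

/-- The cut `δ(S)`: the edges with one end in `S` and the other end outside of `S`. -/
def cut (G : SignedGraph α β) (S : Set α) : Set β :=
  {e | ∃ x y, G.IsLink e x y ∧ x ∈ S ∧ y ∉ S}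

/-- Resigning on `S` replaces the set of odd edges by its symmetric difference with `δ(S)`. -/
def resign (G : SignedGraph α β) (S : Set α) : SignedGraph α β where
  toGraph := G.toGraph
  loopless := G.loopless
  odd := symmDiff G.odd (G.cut S)
  odd_subset := by
    rintro e (⟨h, -⟩ | ⟨⟨x, y, h, -, -⟩, -⟩)
    · exact G.odd_subset h
    · exact h.edge_mem

open Classical in
/-- The contraction of an edge between `u` and `v`: the vertex `v` is identified with `u`, and all
edges between `u` and `v` (which would become loops) are deleted. All other edges keep their
sign. -/
noncomputable def contract (G : SignedGraph α β) (u v : α) : SignedGraph α β where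
  toGraph := (G.toGraph.deleteEdges {f | G.IsLink f u v}).map (fun x => if x = v then u else x)
  loopless := by
    refine ⟨fun f x hf => ?_⟩
    obtain ⟨a, b, hab, ha, hb⟩ := hf
    obtain ⟨h1, h2⟩ : G.IsLink f a b ∧ f ∉ {f | G.IsLink f u v} := by
      rwa [Graph.deleteEdges_isLink] at hab
    have hne : a ≠ b := G.loopless.not_isLoopAt f |> fun h hab => h b (by subst hab; exact h1)
    have h3 : ¬ G.IsLink f u v := h2
    have h4 : G.IsLink f b a := h1.symm
    dsimp only at ha hb
    split_ifs at ha hb <;> subst_vars <;> contradiction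
  odd := G.odd \ {f | G.IsLink f u v}
  odd_subset := by
    rintro f ⟨hf, hf'⟩
    exact ⟨G.odd_subset hf, hf'⟩

/-- `H` arises from `G` by one resigning or by the contraction of one even edge. -/
inductive Step (G : SignedGraph α β) : SignedGraph α β → Prop
  | resign (S : Set α) : Step G (G.resign S)
  | contract (e : β) (u v : α) (he : G.IsLink e u v) (heven : e ∉ G.odd) : Step G (G.contract u v)

/-- `G` is a splitting of `H`: `H` can be obtained from `G` by a (possibly empty) sequence of
resignings and contractions of even edges. -/
def IsSplitting (G H : SignedGraph α β) : Prop := Relation.ReflTransGen Step G H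

/-! ### The completion problem -/

section Completion

variable [Fintype α] [Fintype β]

open Classical in
/-- `X` is a feasible solution of the completion problem `P(G, Σ, c)`. -/
def IsFeasible (G : SignedGraph α β) (c : G.Edge → ℝ) (X : Matrix G.Vert G.Vert ℝ) : Prop :=
  X.PosSemidef ∧ (∀ v, X v v = 1) ∧
    ∀ (e : G.Edge) (x y : G.Vert), G.IsLink e x y →
      if (e : β) ∈ G.odd then X x y ≤ c e else c e ≤ X x y

/-- The set `𝓔(G, Σ)` of all `c ∈ [-1, 1]^E` for which `P(G, Σ, c)` is feasible. -/
def feasibleWeights (G : SignedGraph α β) : Set (G.Edge → ℝ) :=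
  {c | (∀ e, c e ∈ Set.Icc (-1 : ℝ) 1) ∧ ∃ X, G.IsFeasible c X}

/-- `c` is nondegenerate: `c e ≠ 1` on even edges and `c e ≠ -1` on odd edges. -/
def IsNondegenerate (G : SignedGraph α β) (c : G.Edge → ℝ) : Prop :=
  ∀ e : G.Edge, ((e : β) ∉ G.odd → c e ≠ 1) ∧ ((e : β) ∈ G.odd → c e ≠ -1)

open Classical in
/-- The matrix `E_{xy} = (e_x e_yᵀ + e_y e_xᵀ) / 2` of an edge with (distinct) ends `x`, `y`. -/
noncomputable def edgeMatrix (G : SignedGraph α β) (e : G.Edge) : Matrix G.Vert G.Vert ℝ :=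
  Matrix.of fun x y => if G.IsLink e x y then 1 / 2 else 0

open Classical in
/-- The symmetric matrix `Ω = ∑ v, ω(v) E_{vv} + ∑ e, ω(e) E_e` of a stress `ω ∈ ℝ^(V ∪ E)`. -/
noncomputable def stressMatrix (G : SignedGraph α β) (ω : G.Vert ⊕ G.Edge → ℝ) :
    Matrix G.Vert G.Vert ℝ :=
  Matrix.diagonal (fun v => ω (Sum.inl v)) + ∑ e : G.Edge, ω (Sum.inr e) • G.edgeMatrix e

/-- `ω` is properly signed: `ω ≤ 0` on even edges and `ω ≥ 0` on odd edges. These are the sign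
constraints of the dual of `P(G, Σ, c)`. -/
def IsProperlySigned (G : SignedGraph α β) (ω : G.Vert ⊕ G.Edge → ℝ) : Prop :=
  ∀ e : G.Edge, ((e : β) ∉ G.odd → ω (Sum.inr e) ≤ 0) ∧ ((e : β) ∈ G.odd → 0 ≤ ω (Sum.inr e))

open Classical in
/-- The objective function `∑ v, ω(v) + ∑ e, ω(e) c(e)` of the dual of `P(G, Σ, c)`. -/
noncomputable def dualValue (G : SignedGraph α β) (c : G.Edge → ℝ)
    (ω : G.Vert ⊕ G.Edge → ℝ) : ℝ :=
  ∑ v, ω (Sum.inl v) + ∑ e, ω (Sum.inr e) * c e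

end Completion

/-! ### Nested positive semidefinite sequences -/

section Nested

variable {n : Type*} [Fintype n] {k : ℕ}

/-- `𝓥^j = {x | xᵀ Y^i x = 0 for the first j matrices Y^i}`. -/
def nullSet (Y : Fin k → Matrix n n ℝ) (j : ℕ) : Set (n → ℝ) :=
  {x | ∀ i : Fin k, (i : ℕ) < j → x ⬝ᵥ (Y i).mulVec x = 0}

/-- The sequence `Y` is nested PSD: each matrix is positive semidefinite on the space `𝓥`
determined by its predecessors. -/
def IsNestedPSD (Y : Fin k → Matrix n n ℝ) : Prop :=
  ∀ i : Fin k, ∀ x ∈ nullSet Y i, 0 ≤ x ⬝ᵥ (Y i).mulVec x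

end Nested

/-! ### Singularity degree -/

section SingularityDegree

variable [Fintype α] [Fintype β]

open Classical in
/-- There is a sequence of `k` stresses that are properly signed, whose matrices are nested PSD,
whose dual values are nonpositive, and whose rank `|V| - dim 𝓥^k` equals `|V| - s`. Here `s` is the
maximum rank of a feasible solution of `P(G, Σ, c)`, which is the rank of each (relative) interior
point of the feasible set. -/
def HasFacialReduction (G : SignedGraph α β) (c : G.Edge → ℝ) (k : ℕ) : Prop :=
  ∃ ω : Fin k → G.Vert ⊕ G.Edge → ℝ,
    (∀ j, G.IsProperlySigned (ω j)) ∧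
    IsNestedPSD (fun j => G.stressMatrix (ω j)) ∧
    (∀ j, G.dualValue c (ω j) ≤ 0) ∧
    ∃ X, G.IsFeasible c X ∧ (∀ X', G.IsFeasible c X' → X'.rank ≤ X.rank) ∧
      Set.finrank ℝ (nullSet (fun j => G.stressMatrix (ω j)) k) = X.rank

/-- The singularity degree `sd(G, Σ, c)`: the smallest length of a sequence as above. The empty
sequence qualifies if and only if there is a positive definite feasible solution. -/
noncomputable def sdAt (G : SignedGraph α β) (c : G.Edge → ℝ) : ℕ∞ :=
  ⨅ k ∈ {k : ℕ | G.HasFacialReduction c k}, (k : ℕ∞)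

/-- The singularity degree `sd(G, Σ)`. -/
noncomputable def sd (G : SignedGraph α β) : ℕ∞ :=
  ⨆ c ∈ G.feasibleWeights, G.sdAt c

/-- The nondegenerate singularity degree `sd*(G, Σ)`. -/
noncomputable def sdNondeg (G : SignedGraph α β) : ℕ∞ :=
  ⨆ c ∈ {c | c ∈ G.feasibleWeights ∧ G.IsNondegenerate c}, G.sdAt c

end SingularityDegree

end SignedGraph

namespace SignedGraph

variable {α β : Type*}

/-! Call an edge `e = ab` degenerate if `c e` equals its sign `σ`. Positive semidefiniteness then
forces rows `a` and `b` of each feasible `X` to agree up to `σ` (`IsFeasible.col_mem_tightSpace`).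
Resigning makes such an edge even with weight 1, and contracting it loses nothing: feasible matrices
correspond by `X = P X' Pᵀ`, and stresses lift with the same dual value and quadratic form.
Repeating this ends at a nondegenerate `(H, c')`, of which `G` is a splitting
(`exists_isSplitting_nondegenerate`).

All contractions together cost one stress: the sum of the squares `(x a - σ x b)²` over the
degenerate edges of `G` is a properly signed stress of dual value at most 0 that vanishes exactly on
the range of `P` (`exists_stress_tightSpace`). Prefixing it to the lift of a sequence for `(H, c')`
gives the `+ 1` (`ReducesTo.sdAt_le`). The maximum is attained because there are only finitely many
signed graphs on `α` and `β`. -/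

lemma ends_eq_or_eq {G : SignedGraph α β} {e : β} {a b x y : α} (h : G.IsLink e a b)
    (h' : G.IsLink e x y) : (a = x ∧ b = y) ∨ (a = y ∧ b = x) := by
  have h1 := G.eq_or_eq_of_isLink_of_isLink h h'
  have h2 := G.eq_or_eq_of_isLink_of_isLink h.symm h'
  have h3 := G.eq_or_eq_of_isLink_of_isLink h' h
  have h4 := G.eq_or_eq_of_isLink_of_isLink h'.symm h
  grind

lemma exists_ends (G : SignedGraph α β) :
    ∃ a b : G.Edge → G.Vert, ∀ e : G.Edge, G.IsLink e (a e) (b e) := by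
  have h : ∀ e : G.Edge, ∃ a b : G.Vert, G.IsLink e a b := by
    rintro ⟨e, he⟩
    obtain ⟨x, y, h⟩ := (G.edge_mem_iff_exists_isLink e).1 he
    exact ⟨⟨x, h.left_mem⟩, ⟨y, h.right_mem⟩, h⟩
  choose a b hab using h
  exact ⟨a, b, hab⟩

lemma ne_of_isLink {G : SignedGraph α β} {e : β} {a b : α} (h : G.IsLink e a b) : a ≠ b := by
  rintro rfl
  exact G.loopless.not_isLoopAt _ _ h

open Classical in
/-- The sign of an edge: `-1` if it is odd and `1` if it is even. -/
noncomputable def sign (G : SignedGraph α β) (e : β) : ℝ := if e ∈ G.odd then -1 else 1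

lemma sign_mul_self (G : SignedGraph α β) (e : β) : G.sign e * G.sign e = 1 := by
  unfold sign; split_ifs <;> norm_num

/-- The vectors which, up to sign, agree on the ends of each degenerate edge. -/
def tightSpace (G : SignedGraph α β) (c : G.Edge → ℝ) : Set (G.Vert → ℝ) :=
  {x | ∀ (e : G.Edge) (a b : G.Vert), G.IsLink e a b → c e = G.sign e → x a = G.sign e * x b}

open Classical in
lemma isFeasible_iff {G : SignedGraph α β} {c : G.Edge → ℝ} {X : Matrix G.Vert G.Vert ℝ} :
    G.IsFeasible c X ↔ X.PosSemidef ∧ (∀ v, X v v = 1) ∧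
      ∀ (e : G.Edge) (x y : G.Vert), G.IsLink e x y → G.sign e * c e ≤ G.sign e * X x y := by
  unfold IsFeasible sign
  refine and_congr_right fun _ => and_congr_right fun _ => forall_congr' fun e =>
    forall_congr' fun x => forall_congr' fun y => imp_congr_right fun _ => ?_
  split_ifs <;> constructor <;> intro h <;> linarith

lemma isProperlySigned_iff {G : SignedGraph α β} {ω : G.Vert ⊕ G.Edge → ℝ} :
    G.IsProperlySigned ω ↔ ∀ e : G.Edge, G.sign e * ω (Sum.inr e) ≤ 0 := by
  unfold IsProperlySigned sign
  refine forall_congr' fun e => ?_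
  by_cases h : (e : β) ∈ G.odd <;> simp [h]

lemma isNondegenerate_iff {G : SignedGraph α β} {c : G.Edge → ℝ} :
    G.IsNondegenerate c ↔ ∀ e : G.Edge, c e ≠ G.sign e := by
  unfold IsNondegenerate sign
  refine forall_congr' fun e => ?_
  by_cases h : (e : β) ∈ G.odd <;> simp [h]

lemma IsFeasible.col_mem_tightSpace [Fintype α] {G : SignedGraph α β} {c : G.Edge → ℝ}
    {X : Matrix G.Vert G.Vert ℝ} (h : G.IsFeasible c X) (i : G.Vert) :
    (fun v => X v i) ∈ G.tightSpace c := by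
  classical
  obtain ⟨hX, hd, hc⟩ := isFeasible_iff.1 h
  intro e a b hab hce
  have h1 := hc e a b hab
  have h2 := hc e b a hab.symm
  have hs := G.sign_mul_self e
  rw [hce, hs] at h1 h2
  set σ := G.sign e
  -- The form of `X` at `y = e_a - σ e_b` is `2 - 2σ X a b`. The edge constraint makes it at most 0,
  -- so `y` lies in the kernel of `X`.
  set y : G.Vert → ℝ := Pi.single a 1 - σ • Pi.single b 1 with hy
  have hXy : X.mulVec y = fun v => X v a - σ * X v b := by
    ext v
    simp [hy, Matrix.mulVec_sub, Matrix.mulVec_smul]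
  have hq : star y ⬝ᵥ X.mulVec y = X a a - σ * X a b - σ * (X b a - σ * X b b) := by
    rw [hXy, star_trivial, hy]
    simp [sub_dotProduct, smul_dotProduct]
  have h0 : star y ⬝ᵥ X.mulVec y = 0 := by
    refine le_antisymm ?_ (hX.dotProduct_mulVec_nonneg y)
    rw [hq, hd, hd]
    nlinarith
  have h3 := congrFun ((hX.dotProduct_mulVec_zero_iff y).1 h0) i
  rw [hXy] at h3
  have hsym : ∀ v w, X v w = X w v := fun v w => by
    have := hX.1.apply w v
    simpa using this
  simp only [Pi.zero_apply] at h3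
  show X a i = σ * X b i
  rw [hsym a i, hsym b i]
  linarith

/-! ### Quadratic forms of stresses -/

section Finite

variable [Fintype α] [Fintype β]

open Classical in
lemma stressMatrix_quadratic (G : SignedGraph α β) (ω : G.Vert ⊕ G.Edge → ℝ)
    {a b : G.Edge → G.Vert} (hab : ∀ e : G.Edge, G.IsLink e (a e) (b e)) (x : G.Vert → ℝ) :
    x ⬝ᵥ (G.stressMatrix ω).mulVec x =
      ∑ v, ω (Sum.inl v) * x v ^ 2 + ∑ e, ω (Sum.inr e) * (x (a e) * x (b e)) := by
  have hE : ∀ e : G.Edge, x ⬝ᵥ (G.edgeMatrix e).mulVec x = x (a e) * x (b e) := by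
    intro e
    have hne : a e ≠ b e := fun h => ne_of_isLink (hab e) (congrArg Subtype.val h)
    have hm : G.edgeMatrix e = (1 / 2 : ℝ) • (Matrix.single (a e) (b e) (1 : ℝ) +
        Matrix.single (b e) (a e) (1 : ℝ)) := by
      ext i j
      have : G.IsLink e i j ↔ (a e = i ∧ b e = j) ∨ (b e = i ∧ a e = j) := by
        constructor
        · intro h
          rcases ends_eq_or_eq (hab e) h with ⟨h1, h2⟩ | ⟨h1, h2⟩
          · exact Or.inl ⟨Subtype.ext h1, Subtype.ext h2⟩
          · exact Or.inr ⟨Subtype.ext h2, Subtype.ext h1⟩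
        · rintro (⟨rfl, rfl⟩ | ⟨rfl, rfl⟩)
          · exact hab e
          · exact (hab e).symm
      simp only [edgeMatrix, Matrix.of_apply, this, Matrix.smul_apply, Matrix.add_apply,
        Matrix.single_apply, smul_eq_mul]
      split_ifs <;> grind
    rw [hm]
    simp [Matrix.add_mulVec, Matrix.single_mulVec, Function.update_apply, dotProduct,
      Finset.sum_add_distrib, mul_add]
    ring
  simp only [stressMatrix, Matrix.add_mulVec, dotProduct_add, Matrix.sum_mulVec, dotProduct_sum,
    Matrix.smul_mulVec, dotProduct_smul, hE, smul_eq_mul]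
  congr 1
  simp only [dotProduct, Matrix.mulVec_diagonal]
  exact Finset.sum_congr rfl fun v _ => by ring

open Classical in
/-- The stress with quadratic form `∑ (x a - sign e * x b) ^ 2`, summed over the degenerate
edges `e` with ends `a` and `b`. -/
lemma exists_stress_tightSpace (G : SignedGraph α β) (c : G.Edge → ℝ) :
    ∃ ω : G.Vert ⊕ G.Edge → ℝ, G.IsProperlySigned ω ∧ G.dualValue c ω ≤ 0 ∧
      (∀ x, 0 ≤ x ⬝ᵥ (G.stressMatrix ω).mulVec x) ∧
      ∀ x, x ⬝ᵥ (G.stressMatrix ω).mulVec x = 0 ↔ x ∈ G.tightSpace c := by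
  obtain ⟨a, b, hab⟩ := G.exists_ends
  let d : G.Edge → ℝ := fun e => if c e = G.sign e then 1 else 0
  -- Coefficients of the expanded squares `x a ^ 2 + x b ^ 2 - 2σ x a x b`; each contributes `2 - 2σ
  -- c e = 0` to the dual value.
  let ω : G.Vert ⊕ G.Edge → ℝ := Sum.elim
    (fun v => ∑ e, d e * ((if a e = v then 1 else 0) + (if b e = v then 1 else 0)))
    (fun e => -2 * (d e * G.sign e))
  have hd : ∀ e, 0 ≤ d e := fun e => by simp only [d]; split_ifs <;> norm_num
  have hv : ∀ f : G.Vert → ℝ, ∑ v, ω (Sum.inl v) * f v = ∑ e, d e * (f (a e) + f (b e)) := by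
    intro f
    simp only [ω, Sum.elim_inl, Finset.sum_mul]
    rw [Finset.sum_comm]
    refine Finset.sum_congr rfl fun e _ => ?_
    simp [mul_assoc, ← Finset.mul_sum, add_mul, Finset.sum_add_distrib]
  have hq : ∀ x, x ⬝ᵥ (G.stressMatrix ω).mulVec x =
      ∑ e, d e * (x (a e) - G.sign e * x (b e)) ^ 2 := by
    intro x
    rw [G.stressMatrix_quadratic ω hab, hv fun v => x v ^ 2, ← Finset.sum_add_distrib]
    refine Finset.sum_congr rfl fun e _ => ?_
    simp only [ω, Sum.elim_inr]
    linear_combination -(d e * x (b e) ^ 2) * G.sign_mul_self e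
  refine ⟨ω, isProperlySigned_iff.2 fun e => ?_, ?_, fun x => ?_, fun x => ?_⟩
  · simp only [ω, Sum.elim_inr]
    nlinarith [hd e, G.sign_mul_self e]
  · have h1 := hv fun _ => 1
    simp only [mul_one] at h1
    rw [dualValue, h1, ← Finset.sum_add_distrib]
    refine Finset.sum_nonpos fun e _ => ?_
    simp only [ω, Sum.elim_inr, d]
    split_ifs with h
    · rw [h]
      linarith [G.sign_mul_self e]
    · simp
  · rw [hq]
    exact Finset.sum_nonneg fun e _ => mul_nonneg (hd e) (sq_nonneg _)
  · rw [hq, Finset.sum_eq_zero_iff_of_nonneg fun e _ => mul_nonneg (hd e) (sq_nonneg _)]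
    constructor
    · intro h e y z hyz hce
      have h1 := h e (Finset.mem_univ _)
      simp only [d, hce, if_true, one_mul] at h1
      have h2 := pow_eq_zero_iff (two_ne_zero) |>.1 h1
      rcases ends_eq_or_eq (hab e) hyz with ⟨hy, hz⟩ | ⟨hz, hy⟩
      · rw [← Subtype.ext hy, ← Subtype.ext hz]
        linarith
      · rw [← Subtype.ext hy, ← Subtype.ext hz]
        linear_combination -G.sign e * h2 - x (b e) * G.sign_mul_self e
    · intro h e _
      simp only [d]
      split_ifs with hce
      · rw [h e _ _ (hab e) hce]
        simp
      · simp

end Finite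

/-! ### Reductions cost at most one stress -/

section Reduction

variable [Fintype α] [Fintype β]

open Classical in
/-- The completion problem of `(G, c)` reduces to the one of `(H, c')` along an injective matrix
`P` (with left inverse `Q`): the feasible solutions correspond by `X = P X' Pᵀ`, the stresses of `H`
lift to stresses of `G` and the tight space of `G` is the image of the one of `H`. -/
def ReducesTo (G : SignedGraph α β) (c : G.Edge → ℝ) (H : SignedGraph α β) (c' : H.Edge → ℝ) :
    Prop :=
  ∃ (P : Matrix G.Vert H.Vert ℝ) (Q : Matrix H.Vert G.Vert ℝ), Q * P = 1 ∧
    (∀ X, G.IsFeasible c X → ∃ X', H.IsFeasible c' X' ∧ X = P * X' * P.transpose) ∧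
    (∀ X', H.IsFeasible c' X' → G.IsFeasible c (P * X' * P.transpose)) ∧
    (∀ ω', H.IsProperlySigned ω' → ∃ ω, G.IsProperlySigned ω ∧
      G.dualValue c ω = H.dualValue c' ω' ∧ ∀ x, P.mulVec x ⬝ᵥ
        (G.stressMatrix ω).mulVec (P.mulVec x) = x ⬝ᵥ (H.stressMatrix ω').mulVec x) ∧
    G.tightSpace c = P.mulVec '' H.tightSpace c'

lemma ReducesTo.refl (G : SignedGraph α β) (c : G.Edge → ℝ) : G.ReducesTo c G c := by
  classical
  exact ⟨1, 1, by simp, fun X hX => ⟨X, hX, by simp⟩, fun X hX => by simpa using hX,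
    fun ω hω => ⟨ω, hω, rfl, fun x => by simp⟩, by simp⟩

/-- Composability is the reason to carry the tight space along instead of a stress: a chain of
contractions becomes a single reduction, paid for only once. -/
lemma ReducesTo.trans {G H K : SignedGraph α β} {c : G.Edge → ℝ} {c' : H.Edge → ℝ}
    {c'' : K.Edge → ℝ} (h : G.ReducesTo c H c') (h' : H.ReducesTo c' K c'') :
    G.ReducesTo c K c'' := by
  classical
  obtain ⟨P, Q, hQP, hX, hX', hω, hT⟩ := h
  obtain ⟨P', Q', hQP', hY, hY', hω', hT'⟩ := h'
  refine ⟨P * P', Q' * Q, ?_, fun X hXf => ?_, fun X hXf => ?_, fun ω'' hs => ?_, ?_⟩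
  · rw [Matrix.mul_assoc, ← Matrix.mul_assoc Q, hQP, Matrix.one_mul, hQP']
  · obtain ⟨Y, hYf, rfl⟩ := hX X hXf
    obtain ⟨Z, hZf, rfl⟩ := hY Y hYf
    exact ⟨Z, hZf, by simp only [Matrix.transpose_mul, Matrix.mul_assoc]⟩
  · have := hX' _ (hY' X hXf)
    simpa only [Matrix.transpose_mul, Matrix.mul_assoc] using this
  · obtain ⟨ω', hs', hd', hq'⟩ := hω' ω'' hs
    obtain ⟨ω, hs, hd, hq⟩ := hω ω' hs'
    refine ⟨ω, hs, hd.trans hd', fun x => ?_⟩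
    rw [← Matrix.mulVec_mulVec, hq, hq']
  · rw [hT, hT', Set.image_image]
    simp only [Matrix.mulVec_mulVec]

/-- If the tight space of the reduced problem is everything, then one more stress suffices for
the given problem. -/
lemma ReducesTo.hasFacialReduction_succ {G H : SignedGraph α β} {c : G.Edge → ℝ}
    {c' : H.Edge → ℝ} (h : G.ReducesTo c H c') (hc' : H.IsNondegenerate c') {k : ℕ}
    (hk : H.HasFacialReduction c' k) : G.HasFacialReduction c (k + 1) := by
  classical
  obtain ⟨P, Q, hQP, hX, hX', hω, hT⟩ := h
  obtain ⟨ω', hs', hn', hd', X', hf', hmax', hrank'⟩ := hk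
  obtain ⟨ω₀, hs₀, hd₀, hpos₀, hzero₀⟩ := G.exists_stress_tightSpace c
  choose ω hs hd hq using fun j => hω (ω' j) (hs' j)
  -- Without degenerate edges the tight space of `H` is defined by no conditions.
  have hT' : G.tightSpace c = Set.range P.mulVec := by
    have : H.tightSpace c' = Set.univ := Set.eq_univ_of_forall fun x e _ _ _ he =>
      absurd he (isNondegenerate_iff.1 hc' e)
    rw [hT, this, Set.image_univ]
  have hinj : Function.Injective P.mulVec := fun x y hxy => by
    simpa [Matrix.mulVec_mulVec, hQP] using congrArg Q.mulVec hxy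
  -- The new first stress cuts down to the range of `P`, where the others act as those of `H`; hence
  -- the index shift.
  have hnull : ∀ j, nullSet (fun i => G.stressMatrix
      (Fin.cons (α := fun _ => G.Vert ⊕ G.Edge → ℝ) ω₀ ω i)) (j + 1) =
      P.mulVec '' nullSet (fun i => H.stressMatrix (ω' i)) j := by
    intro j
    ext x
    constructor
    · intro hx
      have hx₀ := hx 0 (by simp)
      beta_reduce at hx₀
      rw [Fin.cons_zero, hzero₀, hT'] at hx₀
      obtain ⟨y, rfl⟩ := hx₀
      refine ⟨y, fun i hi => ?_, rfl⟩
      have := hx i.succ (by simpa using hi)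
      beta_reduce at this
      rwa [Fin.cons_succ, hq] at this
    · rintro ⟨y, hy, rfl⟩ i hi
      induction i using Fin.cases with
      | zero =>
        beta_reduce
        rw [Fin.cons_zero, hzero₀, hT']
        exact ⟨y, rfl⟩
      | succ i =>
        beta_reduce
        rw [Fin.cons_succ, hq]
        exact hy i (by simpa using hi)
  -- The left inverse `Q` recovers `Y` from `P Y Pᵀ`, so neither rank exceeds the other.
  have hrank : ∀ Y : Matrix H.Vert H.Vert ℝ, (P * Y * P.transpose).rank = Y.rank := by
    intro Y
    refine le_antisymm ((Matrix.rank_mul_le_left _ _).trans (Matrix.rank_mul_le_right _ _)) ?_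
    have hY : Q * (P * Y * P.transpose) * Q.transpose = Y := by
      have h1 : P.transpose * Q.transpose = 1 := by
        rw [← Matrix.transpose_mul, hQP, Matrix.transpose_one]
      rw [Matrix.mul_assoc, Matrix.mul_assoc, h1, Matrix.mul_one, ← Matrix.mul_assoc, hQP,
        Matrix.one_mul]
    conv_lhs => rw [← hY]
    exact (Matrix.rank_mul_le_left _ _).trans (Matrix.rank_mul_le_right _ _)
  refine ⟨Fin.cons ω₀ ω, Fin.cases hs₀ hs, fun i x hx => ?_,
    Fin.cases hd₀ fun j => (hd j).trans_le (hd' j), P * X' * P.transpose, hX' X' hf',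
    fun Y hY => ?_, ?_⟩
  · induction i using Fin.cases with
    | zero => exact hpos₀ x
    | succ i =>
      rw [Fin.val_succ, hnull] at hx
      obtain ⟨y, hy, rfl⟩ := hx
      simp only [Fin.cons_succ, hq]
      exact hn' i y hy
  · obtain ⟨Y', hY', rfl⟩ := hX Y hY
    rw [hrank, hrank]
    exact hmax' Y' hY'
  · rw [hrank, hnull, ← hrank', Set.finrank, Set.finrank]
    have : P.mulVec = P.mulVecLin := rfl
    rw [this, ← Submodule.map_span]
    exact (Submodule.equivMapOfInjective P.mulVecLin hinj _).finrank_eq.symm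

lemma ReducesTo.sdAt_le {G H : SignedGraph α β} {c : G.Edge → ℝ} {c' : H.Edge → ℝ}
    (h : G.ReducesTo c H c') (hc' : H.IsNondegenerate c') : G.sdAt c ≤ H.sdAt c' + 1 := by
  by_cases hk : {k : ℕ | H.HasFacialReduction c' k}.Nonempty
  · have : H.sdAt c' = ((sInf {k : ℕ | H.HasFacialReduction c' k} : ℕ) : ℕ∞) := by
      refine le_antisymm (iInf₂_le _ (Nat.sInf_mem hk)) (le_iInf₂ fun k hk => ?_)
      exact_mod_cast Nat.sInf_le hk
    rw [this]
    exact iInf₂_le_of_le _ (h.hasFacialReduction_succ hc' (Nat.sInf_mem hk)) (by push_cast; rfl)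
  -- No sequence exists for `H`: the infimum is over the empty set and the bound is trivial.
  · have : H.sdAt c' = ⊤ := by
      simp only [sdAt, iInf_eq_top]
      exact fun k hk' => absurd ⟨k, hk'⟩ hk
    simp [this]

end Reduction

/-! ### Folds: a common form for resigning and contraction -/

/-- A surjection `φ` of the vertices, with signs `s`, that carries the weighted signed graph `(G, c)`
to `(H, c')`. Only edges that join vertices in the same fiber of `φ` may disappear, and on each
fiber the degenerate edges of `G` determine a tight vector from any of its entries. -/
structure IsFold (G : SignedGraph α β) (c : G.Edge → ℝ) (H : SignedGraph α β) (c' : H.Edge → ℝ)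
    (φ : G.Vert → H.Vert) (s : G.Vert → ℝ) : Prop where
  surjective : Function.Surjective φ
  mul_self : ∀ v, s v * s v = 1
  edgeSet_subset : H.edgeSet ⊆ G.edgeSet
  isLink : ∀ e ∈ H.edgeSet, ∀ a b : G.Vert, G.IsLink e a b → H.IsLink e (φ a) (φ b)
  sign_eq : ∀ e ∈ H.edgeSet, ∀ a b : G.Vert, G.IsLink e a b → H.sign e = s a * s b * G.sign e
  weight_eq : ∀ (e : G.Edge) (he : e.1 ∈ H.edgeSet), ∀ a b : G.Vert, G.IsLink e a b →
    c' ⟨e, he⟩ = s a * s b * c e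
  collapse : ∀ e ∉ H.edgeSet, ∀ a b : G.Vert, G.IsLink e a b → φ a = φ b
  fiber : ∀ x ∈ G.tightSpace c, ∀ a b, φ a = φ b → s a * x a = s b * x b

namespace IsFold

variable {G H : SignedGraph α β} {c : G.Edge → ℝ} {c' : H.Edge → ℝ} {φ : G.Vert → H.Vert}
  {s : G.Vert → ℝ}

lemma exists_isLink (h : G.IsFold c H c' φ s) {e : β} {w z : H.Vert} (hwz : H.IsLink e w z) :
    ∃ a b : G.Vert, G.IsLink e a b ∧ φ a = w ∧ φ b = z := by
  obtain ⟨a, b, hab⟩ := (G.edge_mem_iff_exists_isLink e).1 (h.edgeSet_subset hwz.edge_mem)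
  let a' : G.Vert := ⟨a, hab.left_mem⟩
  let b' : G.Vert := ⟨b, hab.right_mem⟩
  have h1 := h.isLink e hwz.edge_mem a' b' hab
  rcases ends_eq_or_eq h1 hwz with ⟨h2, h3⟩ | ⟨h2, h3⟩
  · exact ⟨a', b', hab, Subtype.ext h2, Subtype.ext h3⟩
  · exact ⟨b', a', hab.symm, Subtype.ext h3, Subtype.ext h2⟩

variable [Fintype α]

-- Columns of `X` are tight vectors, so up to the signs `s` the entries of `X` are constant on
-- products of fibers. Restricting to one representative `r w` per fiber therefore loses nothing.
open Classical in
lemma exists_feasible (h : G.IsFold c H c' φ s) {X : Matrix G.Vert G.Vert ℝ}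
    (hX : G.IsFeasible c X) :
    ∃ X', H.IsFeasible c' X' ∧ ∀ a b, X a b = s a * s b * X' (φ a) (φ b) := by
  obtain ⟨r, hr⟩ := h.surjective.hasRightInverse
  let X' : Matrix H.Vert H.Vert ℝ := Matrix.of fun w z => s (r w) * s (r z) * X (r w) (r z)
  obtain ⟨hpsd, hd, hc⟩ := isFeasible_iff.1 hX
  have hsym : ∀ v w, X v w = X w v := fun v w => by simpa using hpsd.1.apply w v
  have hXX' : ∀ a b, X a b = s a * s b * X' (φ a) (φ b) := by
    intro a b
    have h1 : s a * X a b = s (r (φ a)) * X (r (φ a)) b :=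
      h.fiber _ (hX.col_mem_tightSpace b) a (r (φ a)) (hr (φ a)).symm
    have h2 : s b * X b (r (φ a)) = s (r (φ b)) * X (r (φ b)) (r (φ a)) :=
      h.fiber _ (hX.col_mem_tightSpace (r (φ a))) b (r (φ b)) (hr (φ b)).symm
    rw [hsym b, hsym (r (φ b))] at h2
    simp only [X', Matrix.of_apply]
    linear_combination s a * h1 + s a * s (r (φ a)) * s b * h2 - X a b * h.mul_self a -
      s a * s (r (φ a)) * X (r (φ a)) b * h.mul_self b
  refine ⟨X', isFeasible_iff.2 ⟨?_, fun w => ?_, fun e w z hwz => ?_⟩, hXX'⟩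
  · have : X' = Matrix.conjTranspose (Matrix.diagonal fun w => s (r w)) * X.submatrix r r *
        Matrix.diagonal fun w => s (r w) := by
      ext w z
      simp only [X', Matrix.of_apply, Matrix.diagonal_conjTranspose, Matrix.mul_diagonal,
        Matrix.diagonal_mul, Matrix.submatrix_apply, star_trivial]
      ring
    rw [this]
    exact (hpsd.submatrix r).conjTranspose_mul_mul_same _
  · simp only [X', Matrix.of_apply, hd, h.mul_self, mul_one]
  · obtain ⟨a, b, hab, rfl, rfl⟩ := h.exists_isLink hwz
    have h1 := hc ⟨e, hab.edge_mem⟩ a b hab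
    rw [h.sign_eq e hwz.edge_mem a b hab, h.weight_eq ⟨e, hab.edge_mem⟩ hwz.edge_mem a b hab]
    rw [hXX'] at h1
    have hss : s a * s b * (s a * s b) = 1 := by
      linear_combination s b * s b * h.mul_self a + h.mul_self b
    calc s a * s b * G.sign e * (s a * s b * c ⟨e, hab.edge_mem⟩)
        = G.sign e * c ⟨e, hab.edge_mem⟩ := by
          linear_combination G.sign e * c ⟨e, hab.edge_mem⟩ * hss
      _ ≤ _ := h1
      _ = _ := by ring

open Classical in
lemma feasible (h : G.IsFold c H c' φ s) (hc : c ∈ G.feasibleWeights)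
    {X' : Matrix H.Vert H.Vert ℝ} (hX' : H.IsFeasible c' X') :
    G.IsFeasible c (Matrix.of fun a b => s a * s b * X' (φ a) (φ b)) := by
  obtain ⟨hpsd, hd, hc'⟩ := isFeasible_iff.1 hX'
  refine isFeasible_iff.2 ⟨?_, fun v => ?_, fun e a b hab => ?_⟩
  · have : (Matrix.of fun a b => s a * s b * X' (φ a) (φ b)) =
        Matrix.conjTranspose (Matrix.diagonal s) * X'.submatrix φ φ * Matrix.diagonal s := by
      ext w z
      simp only [Matrix.of_apply, Matrix.diagonal_conjTranspose, Matrix.mul_diagonal,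
        Matrix.diagonal_mul, Matrix.submatrix_apply, star_trivial]
      ring
    rw [this]
    exact (hpsd.submatrix φ).conjTranspose_mul_mul_same _
  · simp only [Matrix.of_apply, hd, h.mul_self, mul_one]
  · rw [Matrix.of_apply]
    by_cases he : e.1 ∈ H.edgeSet
    · have h1 := hc' ⟨e, he⟩ _ _ (h.isLink e he a b hab)
      rw [h.sign_eq e he a b hab, h.weight_eq e he a b hab] at h1
      have hss : s a * s b * (s a * s b) = 1 := by
        linear_combination s b * s b * h.mul_self a + h.mul_self b
      calc G.sign e * c e = s a * s b * G.sign e * (s a * s b * c e) := by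
            linear_combination -(G.sign e * c e) * hss
        _ ≤ _ := h1
        _ = _ := by ring
    -- On a deleted edge the entry is `s a * s b` in every matrix of this form. Some feasible `X`
    -- has this form, so the constraint holds.
    · obtain ⟨-, X, hX⟩ := hc
      obtain ⟨Y, hY, hXY⟩ := h.exists_feasible hX
      have h1 := (isFeasible_iff.1 hX).2.2 e a b hab
      rw [hXY, h.collapse e he a b hab, hY.2.1] at h1
      rwa [h.collapse e he a b hab, hd]

lemma mem_feasibleWeights (h : G.IsFold c H c' φ s) (hc : c ∈ G.feasibleWeights) :
    c' ∈ H.feasibleWeights := by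
  obtain ⟨hc, X, hX⟩ := hc
  obtain ⟨X', hX', -⟩ := h.exists_feasible hX
  refine ⟨?_, X', hX'⟩
  rintro ⟨e, he⟩
  obtain ⟨a, b, hab⟩ := (G.edge_mem_iff_exists_isLink e).1 (h.edgeSet_subset he)
  rw [h.weight_eq ⟨e, hab.edge_mem⟩ he ⟨a, hab.left_mem⟩ ⟨b, hab.right_mem⟩ hab]
  rcases mul_self_eq_one_iff.1 (h.mul_self ⟨a, hab.left_mem⟩) with h1 | h1 <;>
  rcases mul_self_eq_one_iff.1 (h.mul_self ⟨b, hab.right_mem⟩) with h2 | h2 <;>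
  · have := hc ⟨e, hab.edge_mem⟩
    rw [h1, h2]
    constructor <;> linarith [this.1, this.2]

lemma tightSpace_eq (h : G.IsFold c H c' φ s) (hc : c ∈ G.feasibleWeights) :
    G.tightSpace c = (fun x a => s a * x (φ a)) '' H.tightSpace c' := by
  obtain ⟨r, hr⟩ := h.surjective.hasRightInverse
  ext x
  constructor
  · intro hx
    have hxr : ∀ a, s a * x a = s (r (φ a)) * x (r (φ a)) := fun a =>
      h.fiber x hx a (r (φ a)) (hr (φ a)).symm
    refine ⟨fun w => s (r w) * x (r w), fun e w z hwz he => ?_, funext fun a => ?_⟩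
    · obtain ⟨a, b, hab, rfl, rfl⟩ := h.exists_isLink hwz
      rw [h.weight_eq ⟨e, hab.edge_mem⟩ e.2 a b hab, h.sign_eq e e.2 a b hab] at he
      have hss : s a * s b * (s a * s b) = 1 := by
        linear_combination s b * s b * h.mul_self a + h.mul_self b
      have h1 := hx ⟨e, hab.edge_mem⟩ a b hab
        (by linear_combination s a * s b * he - (c ⟨e, hab.edge_mem⟩ - G.sign e) * hss)
      beta_reduce
      rw [← hxr, ← hxr, h.sign_eq e e.2 a b hab, h1]
      linear_combination -(s a * G.sign e * x b) * h.mul_self b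
    · simp only
      rw [← hxr]
      linear_combination x a * h.mul_self a
  · rintro ⟨y, hy, rfl⟩ e a b hab hce
    by_cases he : e.1 ∈ H.edgeSet
    · have h1 := hy ⟨e, he⟩ _ _ (h.isLink e he a b hab)
        (by rw [h.weight_eq e he a b hab, h.sign_eq e he a b hab, hce])
      simp only [h1, h.sign_eq e he a b hab]
      linear_combination s b * G.sign e * y (φ b) * h.mul_self a
    -- Feasibility forces `s a * s b = G.sign e` on a degenerate deleted edge, so the fold respects
    -- its sign.
    · obtain ⟨-, X, hX⟩ := hc
      obtain ⟨Y, hY, hXY⟩ := h.exists_feasible hX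
      have h1 : X a b = G.sign e * X b b := hX.col_mem_tightSpace b e a b hab hce
      rw [hXY, h.collapse e he a b hab, hY.2.1, hX.2.1] at h1
      simp only [h.collapse e he a b hab]
      linear_combination s b * y (φ b) * h1 - s a * y (φ b) * h.mul_self b

variable [Fintype β]

open Classical in
lemma exists_stress (h : G.IsFold c H c' φ s) {ω' : H.Vert ⊕ H.Edge → ℝ}
    (hω' : H.IsProperlySigned ω') : ∃ ω, G.IsProperlySigned ω ∧
      G.dualValue c ω = H.dualValue c' ω' ∧ ∀ x : H.Vert → ℝ,
        (fun a => s a * x (φ a)) ⬝ᵥ (G.stressMatrix ω).mulVec (fun a => s a * x (φ a)) =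
          x ⬝ᵥ (H.stressMatrix ω').mulVec x := by
  obtain ⟨r, hr⟩ := h.surjective.hasRightInverse
  obtain ⟨a, b, hab⟩ := G.exists_ends
  let ι : H.Edge → G.Edge := fun e => ⟨e, h.edgeSet_subset e.2⟩
  have hι : Function.Injective ι := fun e f hef => Subtype.ext (congrArg (fun e => e.1) hef)
  have hrange : ∀ e ∉ Set.range ι, e.1 ∉ H.edgeSet := fun e he he' => he ⟨⟨e, he'⟩, rfl⟩
  -- Each vertex weight of `H` goes to the representative of its fiber; deleted edges get weight 0.
  let ω : G.Vert ⊕ G.Edge → ℝ := Sum.elim (fun v => if r (φ v) = v then ω' (Sum.inl (φ v)) else 0)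
    fun e => if he : e.1 ∈ H.edgeSet then s (a e) * s (b e) * ω' (Sum.inr ⟨e, he⟩) else 0
  have hV : ∀ f : H.Vert → ℝ, ∀ g : G.Vert → ℝ, (∀ w, g (r w) = f w) →
      ∑ w, ω' (Sum.inl w) * f w = ∑ v, ω (Sum.inl v) * g v := by
    intro f g hfg
    refine Fintype.sum_of_injective r hr.injective _ _ (fun v hv => ?_) fun w => ?_
    · have : r (φ v) ≠ v := fun hv' => hv ⟨_, hv'⟩
      simp [ω, this]
    · simp [ω, hr w, hfg]
  have hE : ∀ f : H.Edge → ℝ, ∀ g : G.Edge → ℝ,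
      (∀ e, f e = s (a (ι e)) * s (b (ι e)) * g (ι e)) →
      ∑ e, ω' (Sum.inr e) * f e = ∑ e, ω (Sum.inr e) * g e := by
    intro f g hfg
    refine Fintype.sum_of_injective ι hι _ _ (fun e he => ?_) fun e => ?_
    · simp [ω, hrange e he]
    · have he : (ι e).1 ∈ H.edgeSet := e.2
      simp only [ω, Sum.elim_inr, he, dif_pos, hfg]
      simp only [ι]
      ring
  refine ⟨ω, isProperlySigned_iff.2 fun e => ?_, ?_, fun x => ?_⟩
  · by_cases he : e.1 ∈ H.edgeSet
    · have h1 := isProperlySigned_iff.1 hω' ⟨e, he⟩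
      rw [h.sign_eq e he _ _ (hab e)] at h1
      simp only [ω, Sum.elim_inr, he, dif_pos]
      linarith
    · simp [ω, he]
  · have h1 := hV (fun _ => 1) (fun _ => 1) fun _ => rfl
    simp only [mul_one] at h1
    have h2 := hE c' c fun e => h.weight_eq (ι e) e.2 _ _ (hab (ι e))
    rw [dualValue, dualValue, h1, h2]
  · rw [G.stressMatrix_quadratic ω hab, H.stressMatrix_quadratic ω'
      (fun e => h.isLink e e.2 _ _ (hab (ι e)))]
    rw [hV (fun w => x w ^ 2) (fun v => (s v * x (φ v)) ^ 2) fun w => by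
      rw [hr w]; linear_combination x w ^ 2 * h.mul_self (r w)]
    rw [hE (fun e => x (φ (a (ι e))) * x (φ (b (ι e))))
      (fun e => s (a e) * x (φ (a e)) * (s (b e) * x (φ (b e)))) fun e => by
        linear_combination -(x (φ (a (ι e))) * x (φ (b (ι e)))) *
          (s (b (ι e)) * s (b (ι e)) * h.mul_self (a (ι e)) + h.mul_self (b (ι e)))]

lemma reducesTo (h : G.IsFold c H c' φ s) (hc : c ∈ G.feasibleWeights) :
    G.ReducesTo c H c' := by
  classical
  obtain ⟨r, hr⟩ := h.surjective.hasRightInverse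
  let P : Matrix G.Vert H.Vert ℝ := Matrix.of fun a w => if φ a = w then s a else 0
  let Q : Matrix H.Vert G.Vert ℝ := Matrix.of fun w a => if r w = a then s a else 0
  have hP : P.mulVec = fun x a => s a * x (φ a) := by
    ext x a
    simp [P, Matrix.mulVec, dotProduct]
  have hPX : ∀ X : Matrix H.Vert H.Vert ℝ, P * X * P.transpose = Matrix.of fun a b => s a * s b * X (φ a) (φ b) := by
    intro X
    ext a b
    simp [P, Matrix.mul_apply]
    ring
  refine ⟨P, Q, ?_, fun X hX => ?_, fun X' hX' => ?_, fun ω' hω' => ?_, ?_⟩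
  · ext w z
    rw [Matrix.mul_apply, Finset.sum_eq_single (r w) (fun a _ ha => by simp [Q, ha.symm]) (by simp)]
    simp [P, Q, hr w, h.mul_self, Matrix.one_apply]
  · obtain ⟨X', hX', hXX'⟩ := h.exists_feasible hX
    exact ⟨X', hX', by rw [hPX]; ext a b; exact hXX' a b⟩
  · rw [hPX]
    exact h.feasible hc hX'
  · rw [hP]
    exact h.exists_stress hω'
  · rw [hP]
    exact h.tightSpace_eq hc

end IsFold

/-! ### Resigning and contraction are folds -/

open Classical in
lemma isFold_resign (G : SignedGraph α β) (c : G.Edge → ℝ) (S : Set α) :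
    G.IsFold c (G.resign S) (fun e => if e.1 ∈ G.cut S then -c e else c e) id
      (fun v => if v.1 ∈ S then -1 else 1) := by
  have hcut : ∀ e, ∀ a b : α, G.IsLink e a b → (e ∈ G.cut S ↔ ¬(a ∈ S ↔ b ∈ S)) := by
    intro e a b hab
    constructor
    · rintro ⟨x, y, hxy, hx, hy⟩
      rcases ends_eq_or_eq hab hxy with ⟨rfl, rfl⟩ | ⟨rfl, rfl⟩ <;> tauto
    · intro h
      by_cases ha : a ∈ S
      · exact ⟨a, b, hab, ha, by tauto⟩
      · exact ⟨b, a, hab.symm, by tauto, ha⟩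
  -- The signs are chosen so that `s a * s b = -1` exactly on the cut.
  have hs : ∀ e, ∀ a b : G.Vert, G.IsLink e a b →
      (if a.1 ∈ S then (-1 : ℝ) else 1) * (if b.1 ∈ S then -1 else 1) =
        if e ∈ G.cut S then -1 else 1 := by
    intro e a b hab
    have := hcut e a b hab
    split_ifs <;> norm_num <;> tauto
  refine ⟨Function.surjective_id, fun v => ?_, subset_rfl, fun e _ a b hab => hab,
    fun e he a b hab => ?_, fun e he a b hab => ?_, fun e he a b hab => absurd hab.edge_mem he,
    fun x _ a b hab => by rw [show a = b from hab]⟩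
  · split_ifs <;> norm_num
  · rw [hs e a b hab]
    have : e ∈ (G.resign S).odd ↔ ¬(e ∈ G.odd ↔ e ∈ G.cut S) := by
      simp only [resign, Set.mem_symmDiff]
      tauto
    unfold sign
    split_ifs <;> norm_num <;> tauto
  · rw [hs e a b hab]
    dsimp only
    split_ifs
    · exact (neg_one_mul _).symm
    · exact (one_mul _).symm

lemma isLink_contract_iff {G : SignedGraph α β} {u v : α} {e : β} {x y : α} :
    (G.contract u v).IsLink e x y ↔ ∃ a b, (G.IsLink e a b ∧ ¬ G.IsLink e u v) ∧
      (open Classical in if a = v then u else a) = x ∧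
      (open Classical in if b = v then u else b) = y := by
  simp [contract, Relation.Map]

lemma mem_edgeSet_contract_iff {G : SignedGraph α β} {u v : α} {e : β} :
    e ∈ (G.contract u v).edgeSet ↔ e ∈ G.edgeSet ∧ ¬ G.IsLink e u v := by
  simp [contract]

open Classical in
lemma vertexSet_contract (G : SignedGraph α β) (u v : α) :
    (G.contract u v).vertexSet = (fun x => if x = v then u else x) '' G.vertexSet := by
  simp [contract]

open Classical in
lemma isFold_contract (G : SignedGraph α β) (c : G.Edge → ℝ) {u v : α} {e : G.Edge}
    (he : G.IsLink e u v) (heven : e.1 ∉ G.odd) (hc : c e = 1) :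
    G.IsFold c (G.contract u v) (fun f => c ⟨f, (mem_edgeSet_contract_iff.1 f.2).1⟩)
      (fun a => ⟨if a.1 = v then u else a.1, by
        rw [vertexSet_contract]; exact ⟨a.1, a.2, rfl⟩⟩) (fun _ => 1) := by
  refine ⟨?_, fun _ => mul_one 1, fun f hf => (mem_edgeSet_contract_iff.1 hf).1,
    fun f hf a b hab => ?_, fun f hf a b hab => ?_, fun f hf a b hab => ?_,
    fun f hf a b hab => ?_, fun x hx a b hab => ?_⟩
  · rintro ⟨w, hw⟩
    rw [vertexSet_contract] at hw
    obtain ⟨a, ha, rfl⟩ := hw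
    exact ⟨⟨a, ha⟩, rfl⟩
  · exact isLink_contract_iff.2 ⟨a, b, ⟨hab, (mem_edgeSet_contract_iff.1 hf).2⟩, rfl, rfl⟩
  · have : f ∈ (G.contract u v).odd ↔ f ∈ G.odd := by
      simp [contract, (mem_edgeSet_contract_iff.1 hf).2]
    simp only [sign, this, mul_one, one_mul]
  · ring
  · have h1 : G.IsLink f u v := by
      by_contra h1
      exact hf (mem_edgeSet_contract_iff.2 ⟨hab.edge_mem, h1⟩)
    apply Subtype.ext
    rcases ends_eq_or_eq hab h1 with ⟨h2, h3⟩ | ⟨h2, h3⟩ <;> simp [h2, h3]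
  -- The only fiber with two elements is `{u, v}`, and the degenerate edge `e` equates the two
  -- entries.
  · have h1 : x ⟨u, he.left_mem⟩ = x ⟨v, he.right_mem⟩ := by
      have := hx e ⟨u, he.left_mem⟩ ⟨v, he.right_mem⟩ he (by simp [sign, heven, hc])
      simpa [sign, heven] using this
    obtain ⟨a, ha⟩ := a
    obtain ⟨b, hb⟩ := b
    have h2 := congrArg Subtype.val hab
    dsimp only at h2
    split_ifs at h2 <;> subst_vars <;> simp [h1]

lemma ncard_vertexSet_contract_lt [Finite α] (G : SignedGraph α β) {e : β} {u v : α}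
    (he : G.IsLink e u v) : (G.contract u v).vertexSet.ncard < G.vertexSet.ncard := by
  classical
  have hsub : (G.contract u v).vertexSet ⊆ G.vertexSet \ {v} := by
    rw [vertexSet_contract]
    rintro _ ⟨a, ha, rfl⟩
    dsimp only
    split_ifs with h
    · exact ⟨he.left_mem, ne_of_isLink he⟩
    · exact ⟨ha, h⟩
  refine Set.ncard_lt_ncard ?_ (Set.toFinite _)
  exact (hsub.trans Set.sdiff_subset).ssubset_of_not_subset fun h => (hsub (h he.right_mem)).2 rfl

/-- The vertex set, the incidence relation and the odd edges determine a signed graph, the edge set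
being read off from incidence. -/
instance [Finite α] [Finite β] : Finite (SignedGraph α β) := by
  refine Finite.of_injective
    (fun G => (G.vertexSet, G.IsLink, G.odd) : SignedGraph α β →
      Set α × (β → α → α → Prop) × Set β) ?_
  rintro ⟨G, hG, o, ho⟩ ⟨G', hG', o', ho'⟩ h
  simp only [Prod.mk.injEq] at h
  obtain ⟨h1, h2, h3⟩ := h
  have : G = G' := Graph.ext h1 fun e x y => by rw [h2]
  subst this
  subst h3
  rfl

/-! ### Reaching a nondegenerate signed graph -/

section Splitting

variable [Fintype α] [Fintype β]

/-- Contracting the degenerate edges, after making them even by resigning, reduces each weighted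
signed graph to a nondegenerate one. -/
lemma exists_isSplitting_nondegenerate {G : SignedGraph α β} {c : G.Edge → ℝ}
    (hc : c ∈ G.feasibleWeights) : ∃ (H : SignedGraph α β) (c' : H.Edge → ℝ),
      G.IsSplitting H ∧ c' ∈ H.feasibleWeights ∧ H.IsNondegenerate c' ∧ G.ReducesTo c H c' := by
  classical
  induction hn : G.vertexSet.ncard using Nat.strong_induction_on generalizing G with
  | _ n ih =>
    subst hn
    -- Stated for any `G'` on the same vertices, since resigning does not lower the vertex count on
    -- which the induction runs; only the contraction after it does.
    have heven : ∀ (G' : SignedGraph α β) (c₁ : G'.Edge → ℝ), c₁ ∈ G'.feasibleWeights →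
        G'.vertexSet = G.vertexSet → (∃ e : G'.Edge, e.1 ∉ G'.odd ∧ c₁ e = 1) →
        ∃ (H : SignedGraph α β) (c' : H.Edge → ℝ), G'.IsSplitting H ∧ c' ∈ H.feasibleWeights ∧
          H.IsNondegenerate c' ∧ G'.ReducesTo c₁ H c' := by
      rintro G' c₁ hc₁ hV ⟨e, he, hce⟩
      obtain ⟨u, v, huv⟩ := (G'.edge_mem_iff_exists_isLink e).1 e.2
      have hfold := G'.isFold_contract c₁ huv he hce
      have hlt := G'.ncard_vertexSet_contract_lt huv
      rw [hV] at hlt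
      obtain ⟨H, c', hs, hf, hnd, hr⟩ := ih _ hlt (hfold.mem_feasibleWeights hc₁) rfl
      exact ⟨H, c', hs.head (Step.contract e.1 u v huv he), hf, hnd, (hfold.reducesTo hc₁).trans hr⟩
    by_cases hnd : G.IsNondegenerate c
    · exact ⟨G, c, Relation.ReflTransGen.refl, hc, hnd, ReducesTo.refl G c⟩
    · have hnd' := hnd
      rw [isNondegenerate_iff] at hnd'
      push Not at hnd'
      obtain ⟨e, he⟩ := hnd'
      by_cases ho : e.1 ∈ G.odd
      · obtain ⟨u, v, huv⟩ := (G.edge_mem_iff_exists_isLink e).1 e.2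
        -- Resigning on one end puts `e` in the cut: it becomes even and its weight changes from -1
        -- to 1.
        have hfold := G.isFold_resign c {u}
        have hcut : e.1 ∈ G.cut {u} := ⟨u, v, huv, rfl, fun h => ne_of_isLink huv (by simpa using h.symm)⟩
        obtain ⟨H, c', hs, hf, hnd, hr⟩ := heven (G.resign {u}) _ (hfold.mem_feasibleWeights hc) rfl
          ⟨e, by simp [resign, Set.mem_symmDiff, ho, hcut], by simp [hcut, he, sign, ho]⟩
        exact ⟨H, c', hs.head (Step.resign {u}), hf, hnd, (hfold.reducesTo hc).trans hr⟩
      · exact heven G c hc rfl ⟨e, ho, by simp [he, sign, ho]⟩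

end Splitting

end SignedGraph

open SignedGraph in
theorem lemma6p3 {α β : Type*} [Fintype α] [Fintype β] (G : SignedGraph α β) :
    ∃ m : ℕ∞,
      IsGreatest {d : ℕ∞ | ∃ H : SignedGraph α β, G.IsSplitting H ∧ d = H.sdNondeg + 1} m ∧
      G.sd ≤ m := by
  have hfin : {d : ℕ∞ | ∃ H : SignedGraph α β, G.IsSplitting H ∧ d = H.sdNondeg + 1}.Finite :=
    (Set.finite_range fun H : SignedGraph α β => H.sdNondeg + 1).subset
      fun d ⟨H, _, hd⟩ => ⟨H, hd.symm⟩
  have hne : {d : ℕ∞ | ∃ H : SignedGraph α β, G.IsSplitting H ∧ d = H.sdNondeg + 1}.Nonempty :=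
    ⟨_, G, Relation.ReflTransGen.refl, rfl⟩
  obtain ⟨m, hm, hmax⟩ := Set.exists_max_image _ id hfin hne
  refine ⟨m, ⟨hm, hmax⟩, iSup₂_le fun c hc => ?_⟩
  obtain ⟨H, c', hs, hf, hnd, hr⟩ := exists_isSplitting_nondegenerate hc
  calc G.sdAt c ≤ H.sdAt c' + 1 := hr.sdAt_le hnd
    _ ≤ H.sdNondeg + 1 := by
      gcongr
      exact le_iSup₂ (f := fun c _ => H.sdAt c) c' ⟨hf, hnd⟩
    _ ≤ m := hmax _ ⟨H, hs, rfl⟩
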